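/- Let $0<k<n$, $h\ge 1$ and $i\ge 0$ be integers, and let $Gr(k,n)$ be the complex Grassmannian manifold of $k$-dimensional linear subspaces of $\mathbb{C}^n$, with its standard complex structure: for every basis $w_1,\dots,w_k,v_1,\dots,v_{n-k}$ of $\mathbb{C}^n$, with $V_0=\langle v_1,\dots,v_{n-k}\rangle$, the subspaces $H$ with $H\oplus V_0=\mathbb{C}^n$ are parametrised by the $(n-k)\times k$ matrices $A=(a_{lj})$ via $H=\langle w_j+\sum_l a_{lj}v_l : 1\le j\le k\rangle$. Let $$\mathcal{F}_h^i(k,n)=\{(H_1,\dots,H_h)\in Gr(k,n)^h \mid H_j\neq H_l \text{ for } j\neq l,\ \dim(H_1+\cdots+H_h)=i\}.$$ If $\mathcal{F}_h^i(k,n)$ is nonempty, then it is an (embedded) complex submanifold of the product complex manifold $Gr(k,n)^h$, of complex dimension $$d_h^i(k,n)=i(n-i)+hk(i-k)$$ (in particular this integer is nonnegative). That is, around every point of $\mathcal{F}_h^i(k,n)$ there is a holomorphic chart of $Gr(k,n)^h$ in which $\mathcal{F}_h^i(k,n)$ is the part of the chart lying in a complex linear subspace of dimension $d_h^i(k,n)$.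 -/

import Mathlib

open scoped Manifold ContDiff

noncomputable section

/-! ### The complex Grassmannian -/

/-- The Grassmannian `Gr(k, n)`: the set of `k`-dimensional linear subspaces of `ℂⁿ`. -/
def Gr (k n : ℕ) : Type :=
  {H : Submodule ℂ (Fin n → ℂ) // Module.finrank ℂ H = k}

namespace Gr

/-- The coordinate space of `Gr(k, n)`: linear maps `ℂᵏ → ℂⁿ⁻ᵏ`, i.e. `(n - k) × k` matrices. -/
abbrev Model (k n : ℕ) : Type := (Fin k → ℂ) →L[ℂ] (Fin (n - k) → ℂ)

/-- A linear frame of `ℂⁿ`, written as an isomorphism `ℂᵏ × ℂⁿ⁻ᵏ ≃ ℂⁿ`, i.e. a basis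
`w₁, …, w_k, v₁, …, v_{n-k}` of `ℂⁿ`. -/
abbrev Frame (k n : ℕ) : Type := ((Fin k → ℂ) × (Fin (n - k) → ℂ)) ≃ₗ[ℂ] (Fin n → ℂ)

variable {k n : ℕ}

/-- The span `V₀` of the last `n - k` vectors `v₁, …, v_{n-k}` of a frame. -/
def Frame.vert (e : Frame k n) : Submodule ℂ (Fin n → ℂ) :=
  LinearMap.range (e.toLinearMap ∘ₗ LinearMap.inr ℂ (Fin k → ℂ) (Fin (n - k) → ℂ))

/-- The subspace spanned by the columns of the block matrix `(I ; A)`, read in the frame `e`. -/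
def ofModel (e : Frame k n) (A : Model k n) : Gr k n :=
  ⟨(LinearMap.graph (A : (Fin k → ℂ) →ₗ[ℂ] (Fin (n - k) → ℂ))).map e.toLinearMap, by
    rw [LinearEquiv.finrank_map_eq, LinearMap.graph_eq_range_prod,
      LinearMap.finrank_range_of_inj]
    · simp
    · intro x y h
      simpa using congrArg Prod.fst h⟩

theorem mem_ofModel (e : Frame k n) (A : Model k n) (v : Fin n → ℂ) :
    v ∈ (ofModel e A).1 ↔ (e.symm v).2 = A (e.symm v).1 := by
  simp only [ofModel, Submodule.mem_map, LinearMap.mem_graph_iff]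
  constructor
  · rintro ⟨y, hy, rfl⟩
    simpa using hy
  · intro h
    exact ⟨e.symm v, by simpa using h, by simp⟩

theorem ofModel_injective (e : Frame k n) : Function.Injective (ofModel e) := by
  intro A B h
  ext1 x
  have h1 : e (x, A x) ∈ (ofModel e A).1 := by simp [mem_ofModel]
  rw [h, mem_ofModel] at h1
  simpa using h1

theorem mem_vert (e : Frame k n) (v : Fin n → ℂ) : v ∈ e.vert ↔ (e.symm v).1 = 0 := by
  simp only [Frame.vert, LinearMap.mem_range, LinearMap.comp_apply, LinearMap.inr_apply]
  constructor
  · rintro ⟨y, rfl⟩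
    simp
  · intro h
    refine ⟨(e.symm v).2, ?_⟩
    rw [← h]
    simp

/-- The `k`-planes complementary to `V₀` are exactly the ones of the form `(I ; A)`. -/
theorem isCompl_vert_iff (e : Frame k n) (H : Gr k n) :
    IsCompl H.1 e.vert ↔ ∃ A, ofModel e A = H := by
  constructor
  · intro h
    let f : H.1 →ₗ[ℂ] (Fin k → ℂ) × (Fin (n - k) → ℂ) := e.symm.toLinearMap ∘ₗ H.1.subtype
    have hinj : ∀ x y : H.1, (f x).1 = (f y).1 → x = y := by
      intro x y hxy
      have h1 : (x : Fin n → ℂ) - y ∈ e.vert := by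
        rw [mem_vert, map_sub, Prod.fst_sub]
        exact sub_eq_zero.2 hxy
      have h2 := (Submodule.disjoint_def.1 h.disjoint) _ (H.1.sub_mem x.2 y.2) h1
      exact Subtype.ext (sub_eq_zero.1 h2)
    have hsurj : Function.Surjective (Prod.fst ∘ f) := by
      intro x
      have h1 : e (x, 0) ∈ H.1 ⊔ e.vert := by rw [h.sup_eq_top]; trivial
      obtain ⟨y, hy, z, hz, hyz⟩ := Submodule.mem_sup.1 h1
      refine ⟨⟨y, hy⟩, ?_⟩
      have h2 : e.symm y + e.symm z = (x, 0) := by rw [← map_add, hyz]; simp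
      have h3 := congrArg Prod.fst h2
      rw [Prod.fst_add, (mem_vert e z).1 hz, add_zero] at h3
      exact h3
    obtain ⟨g, hg⟩ := LinearMap.exists_range_eq_graph hsurj
      (fun x y hxy => by rw [hinj x y hxy])
    refine ⟨LinearMap.toContinuousLinearMap g, Subtype.ext ?_⟩
    change Submodule.map e.toLinearMap g.graph = H.1
    rw [← hg]
    ext v
    simp [f]
  · rintro ⟨A, rfl⟩
    constructor
    · rw [Submodule.disjoint_def]
      intro v hv hv'
      rw [mem_ofModel] at hv
      rw [mem_vert] at hv'
      rw [hv', map_zero] at hv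
      exact (e.symm.map_eq_zero_iff).1 (Prod.ext hv' hv)
    · rw [codisjoint_iff, eq_top_iff]
      intro v _
      refine Submodule.mem_sup.2 ⟨e ((e.symm v).1, A (e.symm v).1), ?_,
        e (0, (e.symm v).2 - A (e.symm v).1), ?_, ?_⟩
      · simp [mem_ofModel]
      · simp [mem_vert]
      · rw [← map_add]
        simp

open Classical in
/-- The chart of `Gr(k, n)` attached to a frame `e` with vertical space `V₀`: its domain is
`U_{V₀} = {H | H ⊕ V₀ = ℂⁿ}` and it sends `H` to the unique `A` such that `H` is spanned by
the columns of `(I ; A)` in the frame `e`. -/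
def chart (e : Frame k n) : PartialEquiv (Gr k n) (Model k n) where
  toFun := Function.invFun (ofModel e)
  invFun := ofModel e
  source := {H | IsCompl H.1 e.vert}
  target := Set.univ
  map_source' _ _ := trivial
  map_target' A _ := (isCompl_vert_iff e _).2 ⟨A, rfl⟩
  left_inv' H hH := Function.invFun_eq ((isCompl_vert_iff e H).1 hH)
  right_inv' A _ := Function.leftInverse_invFun (ofModel_injective e) A

theorem exists_frame (H : Gr k n) : ∃ e : Frame k n, H ∈ (chart e).source := by
  obtain ⟨V, hV⟩ := Submodule.exists_isCompl H.1
  have h1 : Module.finrank ℂ H.1 = k := H.2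
  have h2 : Module.finrank ℂ V = n - k := by
    have := Submodule.finrank_add_eq_of_isCompl hV
    rw [h1, Module.finrank_fin_fun] at this
    omega
  let a : (Fin k → ℂ) ≃ₗ[ℂ] H.1 := LinearEquiv.ofFinrankEq _ _ (by simp [h1])
  let b : (Fin (n - k) → ℂ) ≃ₗ[ℂ] V := LinearEquiv.ofFinrankEq _ _ (by simp [h2])
  let e : Frame k n := (a.prodCongr b).trans (Submodule.prodEquivOfIsCompl H.1 V hV)
  refine ⟨e, ?_⟩
  have hv : e.vert = V := by
    ext v
    simp only [Frame.vert, LinearMap.mem_range]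
    constructor
    · rintro ⟨y, rfl⟩
      simp [e]
    · intro hv
      exact ⟨b.symm ⟨v, hv⟩, by simp [e]⟩
  change IsCompl H.1 e.vert
  rw [hv]
  exact hV

/-- The upper block row of the matrix of the change of frame applied to `(I ; A)`. -/
def transTop (e e' : Frame k n) (A : Model k n) : (Fin k → ℂ) →L[ℂ] (Fin k → ℂ) :=
  (ContinuousLinearMap.fst ℂ _ _ ∘L (e.trans e'.symm).toContinuousLinearEquiv.toContinuousLinearMap)
    ∘L ((ContinuousLinearMap.id ℂ (Fin k → ℂ)).prod A)

/-- The lower block row of the matrix of the change of frame applied to `(I ; A)`. -/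
def transBot (e e' : Frame k n) (A : Model k n) : Model k n :=
  (ContinuousLinearMap.snd ℂ _ _ ∘L (e.trans e'.symm).toContinuousLinearEquiv.toContinuousLinearMap)
    ∘L ((ContinuousLinearMap.id ℂ (Fin k → ℂ)).prod A)

theorem ofModel_eq_iff (e e' : Frame k n) (A A' : Model k n) :
    ofModel e A = ofModel e' A' ↔
      (transTop e e' A).IsInvertible ∧ A' = transBot e e' A ∘L (transTop e e' A).inverse := by
  have key : (∀ x, transBot e e' A x = A' (transTop e e' A x)) ↔
      (ofModel e A).1 ≤ (ofModel e' A').1 := by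
    constructor
    · intro h v hv
      rw [mem_ofModel] at hv ⊢
      have := h (e.symm v).1
      have h2 : e ((e.symm v).1, A (e.symm v).1) = v := by
        rw [← hv]; simp
      simpa [transBot, transTop, h2] using this
    · intro h x
      have h1 : e (x, A x) ∈ (ofModel e A).1 := by simp [mem_ofModel]
      have h2 := h h1
      rw [mem_ofModel] at h2
      simpa [transBot, transTop] using h2
  constructor
  · intro h
    have hle := key.2 (le_of_eq (congrArg Subtype.val h))
    have hsurj : Function.Surjective (transTop e e' A) := by
      intro y
      have h1 : e' (y, A' y) ∈ (ofModel e' A').1 := by simp [mem_ofModel]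
      rw [← h, mem_ofModel] at h1
      refine ⟨(e.symm (e' (y, A' y))).1, ?_⟩
      simp only [transTop, ContinuousLinearMap.comp_apply, ContinuousLinearMap.prod_apply,
        ContinuousLinearMap.id_apply]
      rw [← h1]
      simp
    have hinj : Function.Injective (transTop e e' A) :=
      (LinearMap.injective_iff_surjective (f := (transTop e e' A).toLinearMap)).2 hsurj
    have hinv : (transTop e e' A).IsInvertible :=
      ⟨(LinearEquiv.ofBijective (transTop e e' A).toLinearMap
        ⟨hinj, hsurj⟩).toContinuousLinearEquiv, by ext x; rfl⟩
    refine ⟨hinv, ?_⟩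
    ext1 y
    obtain ⟨x, rfl⟩ := hsurj y
    rw [ContinuousLinearMap.comp_apply, hinv.inverse_apply_eq.2 rfl, hle]
  · rintro ⟨hinv, rfl⟩
    refine Subtype.ext (Submodule.eq_of_le_of_finrank_eq (key.1 fun x => ?_)
      ((ofModel e A).2.trans (ofModel e' _).2.symm))
    rw [ContinuousLinearMap.comp_apply, hinv.inverse_apply_eq.2 rfl]

theorem trans_source (e e' : Frame k n) :
    ((chart e).symm.trans (chart e')).source = {A | (transTop e e' A).IsInvertible} := by
  ext A
  simp only [PartialEquiv.trans_source, PartialEquiv.symm_source, Set.mem_inter_iff,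
    Set.mem_preimage, Set.mem_ofPred_eq]
  constructor
  · rintro ⟨-, h⟩
    obtain ⟨A', hA'⟩ := (isCompl_vert_iff e' _).1 h
    exact ((ofModel_eq_iff e e' A A').1 hA'.symm).1
  · intro h
    exact ⟨trivial, (isCompl_vert_iff e' _).2
      ⟨_, ((ofModel_eq_iff e e' A _).2 ⟨h, rfl⟩).symm⟩⟩

theorem trans_eqOn (e e' : Frame k n) :
    Set.EqOn ((chart e).symm.trans (chart e'))
      (fun A => transBot e e' A ∘L (transTop e e' A).inverse)
      {A | (transTop e e' A).IsInvertible} := by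
  intro A hA
  have h := (ofModel_eq_iff e e' A _).2 ⟨hA, rfl⟩
  change Function.invFun (ofModel e') (ofModel e A) = _
  rw [h]
  exact Function.leftInverse_invFun (ofModel_injective e') _

theorem contDiff_id_prod : ContDiff ℂ ω
    (fun A : Model k n => (ContinuousLinearMap.id ℂ (Fin k → ℂ)).prod A) := by
  have h : (fun A : Model k n => (ContinuousLinearMap.id ℂ (Fin k → ℂ)).prod A) =
      fun A => ContinuousLinearMap.inl ℂ _ _ + ContinuousLinearMap.inr ℂ _ _ ∘L A := by
    ext A x <;> simp
  rw [h]
  exact contDiff_const.add (contDiff_const.clm_comp contDiff_id)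

theorem contDiff_transTop (e e' : Frame k n) : ContDiff ℂ ω (transTop e e') :=
  contDiff_const.clm_comp contDiff_id_prod

theorem contDiff_transBot (e e' : Frame k n) : ContDiff ℂ ω (transBot e e') :=
  contDiff_const.clm_comp contDiff_id_prod

/-- The changes of charts are holomorphic. -/
theorem contDiffOn_trans (e e' : Frame k n) :
    ContDiffOn ℂ ω ((chart e).symm.trans (chart e'))
      ((chart e).symm.trans (chart e')).source := by
  rw [trans_source]
  refine ContDiffOn.congr (fun A hA => ContDiffAt.contDiffWithinAt ?_) (trans_eqOn e e')
  exact (contDiff_transBot e e').contDiffAt.clm_comp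
    (ContDiffAt.comp A hA.contDiffAt_map_inverse (contDiff_transTop e e').contDiffAt)

/-- The atlas of `Gr(k, n)` given by all the charts `U_{V₀} → Model k n`. -/
def core (k n : ℕ) : ChartedSpaceCore (Model k n) (Gr k n) where
  atlas := Set.range chart
  chartAt H := chart (exists_frame H).choose
  mem_chart_source H := (exists_frame H).choose_spec
  chart_mem_atlas _ := ⟨_, rfl⟩
  open_source := by
    rintro _ _ ⟨e, rfl⟩ ⟨e', rfl⟩
    rw [trans_source]
    exact ContinuousLinearEquiv.isOpen.preimage (contDiff_transTop e e').continuous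
  continuousOn_toFun := by
    rintro _ _ ⟨e, rfl⟩ ⟨e', rfl⟩
    exact (contDiffOn_trans e e').continuousOn

/-- The topology of `Gr(k, n)` for which the charts are homeomorphisms from open sets. -/
instance : TopologicalSpace (Gr k n) := (core k n).toTopologicalSpace

instance : ChartedSpace (Model k n) (Gr k n) := (core k n).toChartedSpace

/-- `Gr(k, n)` is a complex manifold. -/
instance : IsManifold 𝓘(ℂ, Model k n) ω (Gr k n) := by
  refine isManifold_of_contDiffOn _ _ _ ?_
  intro f g hf hg
  obtain ⟨_, ⟨e, rfl⟩, hf⟩ := Set.mem_iUnion₂.1 hf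
  obtain ⟨_, ⟨e', rfl⟩, hg⟩ := Set.mem_iUnion₂.1 hg
  rw [Set.mem_singleton_iff] at hf hg
  subst hf hg
  refine (contDiffOn_trans e e').mono ?_
  intro A hA
  exact hA.1

end Gr

/-! ### Finite products of complex manifolds -/

section Pi

variable {ι : Type*} [Fintype ι] {E : ι → Type*} [∀ i, NormedAddCommGroup (E i)]
  [∀ i, NormedSpace ℂ (E i)] {H : ι → Type*} [∀ i, TopologicalSpace (H i)]
  (I : ∀ i, ModelWithCorners ℂ (E i) (H i))

instance ModelWithCorners.pi_boundaryless [∀ i, (I i).Boundaryless] :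
    (ModelWithCorners.pi I).Boundaryless := by
  constructor
  change Set.range (fun (x : ∀ i, H i) i => I i (x i)) = Set.univ
  refine Set.range_eq_univ.2 fun y => ?_
  choose x hx using fun i => (Set.range_eq_univ.1 (I i).range_eq_univ) (y i)
  exact ⟨x, funext hx⟩

/-- A finite product of complex manifolds is a complex manifold. -/
instance IsManifold.pi {M : ι → Type*} [∀ i, TopologicalSpace (M i)]
    [∀ i, ChartedSpace (H i) (M i)] [∀ i, IsManifold (I i) ω (M i)] :
    IsManifold (ModelWithCorners.pi I) ω (∀ i, M i) := by
  refine isManifold_of_contDiffOn _ _ _ ?_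
  rintro _ _ ⟨f, hf, rfl⟩ ⟨g, hg, rfl⟩
  refine contDiffOn_pi.2 fun i => ?_
  have h := (contDiffGroupoid ω (I i)).compatible (hf i trivial) (hg i trivial)
  have h1 : ContDiffOn ℂ ω (I i ∘ ((f i).symm ≫ₕ g i) ∘ (I i).symm)
      ((I i).symm ⁻¹' ((f i).symm ≫ₕ g i).source ∩ Set.range (I i)) :=
    (mem_groupoid_of_pregroupoid.1 h).1
  refine h1.comp (ContinuousLinearMap.proj (R := ℂ) (φ := E) i).contDiff.contDiffOn ?_
  rintro x ⟨⟨hx1, hx2⟩, y, rfl⟩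
  exact ⟨⟨hx1 i trivial, hx2 i trivial⟩, y i, rfl⟩

end Pi

/-! ### Complex submanifolds -/

/-- `S` is an (embedded) complex submanifold of complex dimension `d` of the complex manifold `M`:
around each point of `S` there is a holomorphic chart of `M` in which `S` is cut out by a complex
linear subspace of dimension `d` of the coordinate space. -/
def IsComplexSubmanifold {E : Type*} [NormedAddCommGroup E] [NormedSpace ℂ E]
    [FiniteDimensional ℂ E] {H : Type*} [TopologicalSpace H] (I : ModelWithCorners ℂ E H)
    [I.Boundaryless] {M : Type*} [TopologicalSpace M] [ChartedSpace H M] [IsManifold I ω M]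
    (S : Set M) (d : ℕ) : Prop :=
  ∀ x ∈ S, ∃ φ ∈ IsManifold.maximalAtlas I ω M, x ∈ φ.source ∧
    ∃ W : Submodule ℂ E, Module.finrank ℂ W = d ∧
      ∀ y ∈ φ.source, y ∈ S ↔ φ.extend I y ∈ W

/-! ### Configuration spaces of the Grassmannian -/

/-- The model with corners (without boundary) of the complex manifold `Gr(k, n)^h`. -/
abbrev grPowModel (h k n : ℕ) :
    ModelWithCorners ℂ (Fin h → Gr.Model k n) (ModelPi fun _ : Fin h => Gr.Model k n) :=
  ModelWithCorners.pi fun _ => 𝓘(ℂ, Gr.Model k n)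

/-- The `i`-th ordered configuration space `F_h^i(k, n)`: `h`-tuples of pairwise distinct
`k`-planes of `ℂⁿ` whose sum has dimension `i`. -/
def orderedConfig (h i k n : ℕ) : Set (Fin h → Gr k n) :=
  {P | Function.Injective P ∧ Module.finrank ℂ ↥(⨆ j, (P j).1) = i}

end

/-!
At a point `(H₁, …, H_h)` of the configuration space let `S = H₁ + ⋯ + H_h`, choose a complement `T`
of `S` in `ℂⁿ`, and for each `j` a frame in which `H_j` has coordinate `0` and whose vertical space
contains `T`. In the coordinates `A = (A₁, …, A_h)` of these frames, the sum of the planes is the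
range of a linear map `M A : (ℂᵏ)ʰ → ℂⁿ` depending affinely on `A`. Let `L A` and `D A` be its
components in `S` and `T`. The map `L 0` is onto `S`, hence so is `L A` for `A` near `0`, and then the
sum of the planes has dimension `dim S` exactly when `ker (L A) ≤ ker (D A)`
(`finrank_range_eq_iff_ker_le`).

This condition is nonlinear because `ker (L A)` moves. Fix a right inverse `r` of `L 0` and let `Q A`
be the projection of `(ℂᵏ)ʰ` onto the range of `r` along `ker (L A)`. All the `Q A` have the same range,
so `Q A - Q 0` squares to zero and `1 - (Q A - Q 0)` is an automorphism, which maps `ker (L 0)` onto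
`ker (L A)`. As `T` lies in all the vertical spaces, `D A` can be changed arbitrarily without changing
`L A`; replacing `D A` by `D A ∘ (1 - (Q A - Q 0))` in this way is a local biholomorphism
(`straighten`), and it turns the condition into the linear condition that `D` vanishes on `ker (L 0)`
(`ker_le_ker_iff_straighten`). The latter says that `hk - i` vectors are killed by a map to a space of
dimension `n - i`, so it has codimension `(hk - i)(n - i)` in the space of all `A`, of dimension
`hk(n - k)`. Distinctness of the planes is an open condition (`Gr.isOpen_injective_ofModel`), and
only restricts the domain of the chart.
-/

open scoped Manifold ContDiff

noncomputable section

/-! ### Straightening a rank condition -/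

section Straighten

variable {E N S T : Type*} [NormedAddCommGroup E] [NormedSpace ℂ E]
  [NormedAddCommGroup N] [NormedSpace ℂ N] [NormedAddCommGroup S] [NormedSpace ℂ S]
  [NormedAddCommGroup T] [NormedSpace ℂ T]

/-- For `l : N → S` with `l ∘ r` invertible, the projection of `N` onto the range of `r` along the
kernel of `l`. -/
def projAlongKer (r : S →L[ℂ] N) (l : N →L[ℂ] S) : N →L[ℂ] N :=
  r ∘L (l ∘L r).inverse ∘L l

theorem apply_projAlongKer {r : S →L[ℂ] N} {l : N →L[ℂ] S} (hl : (l ∘L r).IsInvertible) (x : N) :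
    l (projAlongKer r l x) = l x :=
  hl.self_apply_inverse (l x)

/-- The projections onto the range of `r` along different kernels absorb each other. -/
theorem projAlongKer_projAlongKer {r : S →L[ℂ] N} {l : N →L[ℂ] S} (hl : (l ∘L r).IsInvertible)
    (l' : N →L[ℂ] S) (x : N) :
    projAlongKer r l (projAlongKer r l' x) = projAlongKer r l' x :=
  congrArg r (hl.inverse_apply_self ((l' ∘L r).inverse (l' x)))

theorem projAlongKer_eq_zero {r : S →L[ℂ] N} {l : N →L[ℂ] S} {x : N} (hx : l x = 0) :
    projAlongKer r l x = 0 := by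
  simp [projAlongKer, hx]

variable (L : E → N →L[ℂ] S) (D : E →L[ℂ] N →L[ℂ] T) (s : (N →L[ℂ] T) →L[ℂ] E) (r : S →L[ℂ] N)

/-- The correction term of the straightening map. -/
def shear (a : E) : E :=
  s (D a ∘L (projAlongKer r (L a) - projAlongKer r (L 0)))

variable {L D s r}

theorem contDiffAt_shear [CompleteSpace S] (hL : ContDiff ℂ ω L) {a : E}
    (ha : (L a ∘L r).IsInvertible) : ContDiffAt ℂ ω (shear L D s r) a := by
  have h1 : ContDiffAt ℂ ω (fun a => (L a ∘L r).inverse) a :=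
    ContDiffAt.comp (f := fun a => L a ∘L r) (g := ContinuousLinearMap.inverse) a
      ha.contDiffAt_map_inverse (hL.clm_comp contDiff_const).contDiffAt
  have h2 : ContDiffAt ℂ ω (fun a => projAlongKer r (L a)) a :=
    contDiffAt_const.clm_comp (h1.clm_comp hL.contDiffAt)
  exact s.contDiff.contDiffAt.comp a
    (D.contDiff.contDiffAt.clm_comp (h2.sub contDiffAt_const))

/-- Since `L` does not see the correction term, the correction term at a corrected point is computed
with the same projections; as the difference of two projections onto the same space squares to
zero, it is unchanged. -/
theorem shear_add_smul_shear (hLs : ∀ a f, L (a + s f) = L a) (hDs : ∀ f, D (s f) = f)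
    (h0 : (L 0 ∘L r).IsInvertible) {a : E} (ha : (L a ∘L r).IsInvertible) (c : ℂ) :
    shear L D s r (a + c • shear L D s r a) = shear L D s r a := by
  have hLa : L (a + c • shear L D s r a) = L a := by
    rw [shear, ← map_smul, hLs]
  rw [shear, hLa, map_add, map_smul]
  conv_rhs => rw [shear]
  congr 1
  ext x
  simp only [shear, hDs, ContinuousLinearMap.comp_apply, sub_apply,
    add_apply, smul_apply, map_sub,
    projAlongKer_projAlongKer ha, projAlongKer_projAlongKer h0]
  simp

/-- The local biholomorphism `a ↦ a - s (D a ∘ (Q a - Q 0))`, where `Q a` is the projection onto the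
range of `r` along `ker (L a)`. It turns the condition `ker (L a) ≤ ker (D a)` into a linear one. -/
def straighten [CompleteSpace S] (hL : ContDiff ℂ ω L) (hLs : ∀ a f, L (a + s f) = L a)
    (hDs : ∀ f, D (s f) = f) (h0 : (L 0 ∘L r).IsInvertible) : OpenPartialHomeomorph E E where
  toFun a := a + (-1 : ℂ) • shear L D s r a
  invFun a := a + (1 : ℂ) • shear L D s r a
  source := {a | (L a ∘L r).IsInvertible}
  target := {a | (L a ∘L r).IsInvertible}
  map_source' a ha := by
    change (L (a + _) ∘L r).IsInvertible
    rw [shear, ← map_smul, hLs]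
    exact ha
  map_target' a ha := by
    change (L (a + _) ∘L r).IsInvertible
    rw [shear, ← map_smul, hLs]
    exact ha
  left_inv' a ha := by
    rw [shear_add_smul_shear hLs hDs h0 ha]
    simp
  right_inv' a ha := by
    rw [shear_add_smul_shear hLs hDs h0 ha]
    simp
  open_source := ContinuousLinearEquiv.isOpen.preimage (hL.clm_comp contDiff_const).continuous
  open_target := ContinuousLinearEquiv.isOpen.preimage (hL.clm_comp contDiff_const).continuous
  continuousOn_toFun a ha := (contDiffAt_id.add (contDiffAt_const.smul
    (contDiffAt_shear hL ha))).continuousAt.continuousWithinAt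
  continuousOn_invFun a ha := (contDiffAt_id.add (contDiffAt_const.smul
    (contDiffAt_shear hL ha))).continuousAt.continuousWithinAt

theorem contDiffOn_straighten [CompleteSpace S] (hL : ContDiff ℂ ω L)
    (hLs : ∀ a f, L (a + s f) = L a) (hDs : ∀ f, D (s f) = f) (h0 : (L 0 ∘L r).IsInvertible) :
    ContDiffOn ℂ ω (straighten hL hLs hDs h0) (straighten hL hLs hDs h0).source :=
  fun _ ha => (contDiffAt_id.add (contDiffAt_const.smul
    (contDiffAt_shear hL ha))).contDiffWithinAt

theorem contDiffOn_straighten_symm [CompleteSpace S] (hL : ContDiff ℂ ω L)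
    (hLs : ∀ a f, L (a + s f) = L a) (hDs : ∀ f, D (s f) = f) (h0 : (L 0 ∘L r).IsInvertible) :
    ContDiffOn ℂ ω (straighten hL hLs hDs h0).symm (straighten hL hLs hDs h0).target :=
  fun _ ha => (contDiffAt_id.add (contDiffAt_const.smul
    (contDiffAt_shear hL ha))).contDiffWithinAt

/-- In the straightened coordinates the moving space `ker (L a)` is replaced by the fixed space
`ker (L 0)`. -/
theorem ker_le_ker_iff_straighten [CompleteSpace S] (hL : ContDiff ℂ ω L)
    (hLs : ∀ a f, L (a + s f) = L a) (hDs : ∀ f, D (s f) = f) (h0 : (L 0 ∘L r).IsInvertible)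
    {a : E} (ha : a ∈ (straighten hL hLs hDs h0).source) :
    (∀ x, L a x = 0 → D a x = 0) ↔
      ∀ x, L 0 x = 0 → D (straighten hL hLs hDs h0 a) x = 0 := by
  -- On `ker (L 0)` the new `D` is the old one precomposed with the projection onto `ker (L a)`.
  have key : ∀ x, L 0 x = 0 → D (straighten hL hLs hDs h0 a) x
      = D a (x - projAlongKer r (L a) x) := by
    intro x hx
    have h1 : straighten hL hLs hDs h0 a = a + (-1 : ℂ) • shear L D s r a := rfl
    rw [h1, map_add, map_smul, shear, hDs]
    simp [projAlongKer_eq_zero hx, sub_eq_add_neg]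
  replace ha : (L a ∘L r).IsInvertible := ha
  constructor
  · intro h x hx
    rw [key x hx]
    apply h
    rw [map_sub, apply_projAlongKer ha, sub_self]
  · intro h x hx
    have h1 : L 0 (x - projAlongKer r (L 0) x) = 0 := by
      rw [map_sub, apply_projAlongKer h0, sub_self]
    have h2 := h _ h1
    rw [key _ h1, map_sub (projAlongKer r (L a)), projAlongKer_projAlongKer ha,
      projAlongKer_eq_zero hx] at h2
    simpa using h2

end Straighten

/-! ### Changes of charts -/

/-- Composing a chart of the maximal atlas with a local biholomorphism of the model gives a chart. -/
theorem StructureGroupoid.trans_mem_maximalAtlas {H M : Type*} [TopologicalSpace H]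
    [TopologicalSpace M] [ChartedSpace H M] {G : StructureGroupoid H}
    {e : OpenPartialHomeomorph M H} (he : e ∈ G.maximalAtlas M)
    {f : OpenPartialHomeomorph H H} (hf : f ∈ G) : e ≫ₕ f ∈ G.maximalAtlas M := by
  rw [mem_maximalAtlas_iff] at he ⊢
  intro e' he'
  constructor
  · rw [OpenPartialHomeomorph.trans_symm_eq_symm_trans_symm, OpenPartialHomeomorph.trans_assoc]
    exact G.trans (G.symm hf) (he e' he').1
  · rw [← OpenPartialHomeomorph.trans_assoc]
    exact G.trans (he e' he').2 hf

/-! ### Dimension of a sum of planes -/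

section Rank

variable {N V : Type*} [AddCommGroup N] [Module ℂ N] [FiniteDimensional ℂ N]
  [AddCommGroup V] [Module ℂ V] {S T : Submodule ℂ V}

/-- Once the `S`-component of `M` is onto, the rank of `M` is at least `dim S`, with equality exactly
when `M` has the same kernel as its `S`-component. -/
theorem finrank_range_eq_iff_ker_le (hST : IsCompl S T) (M : N →ₗ[ℂ] V)
    (hM : Function.Surjective (S.projectionOnto T hST ∘ₗ M)) :
    Module.finrank ℂ (LinearMap.range M) = Module.finrank ℂ S ↔
      ∀ x, S.projectionOnto T hST (M x) = 0 → T.projectionOnto S hST.symm (M x) = 0 := by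
  have h1 := LinearMap.finrank_range_add_finrank_ker M
  have h2 := LinearMap.finrank_range_add_finrank_ker (S.projectionOnto T hST ∘ₗ M)
  rw [LinearMap.range_eq_top.2 hM, finrank_top] at h2
  have hle : LinearMap.ker M ≤ LinearMap.ker (S.projectionOnto T hST ∘ₗ M) :=
    LinearMap.ker_le_ker_comp _ _
  constructor
  · intro h x hx
    have h3 := Submodule.eq_of_le_of_finrank_eq hle (by omega)
    have h4 : x ∈ LinearMap.ker M := by rw [h3]; exact hx
    rw [LinearMap.mem_ker.1 h4, map_zero]
  · intro h
    have h3 : LinearMap.ker (S.projectionOnto T hST ∘ₗ M) ≤ LinearMap.ker M := by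
      intro x hx
      have h5 := h x hx
      replace hx : S.projectionOnto T hST (M x) = 0 := hx
      rw [Submodule.projectionOnto_apply_eq_zero_iff] at hx h5
      exact (Submodule.disjoint_def.1 hST.disjoint) _ h5 hx
    rw [le_antisymm hle h3] at h1
    omega

end Rank

/-! ### Frames adapted to a sum of planes -/

namespace Gr

variable {h k n : ℕ}

/-- The zero matrix represents the span of the first `k` vectors of the frame. -/
theorem apply_inl_mem_ofModel_zero (e : Frame k n) (x : Fin k → ℂ) :
    e (x, 0) ∈ (ofModel e 0).1 := by
  simp [mem_ofModel]

/-- A plane disjoint from `T` is the origin of a chart whose vertical space contains `T`. -/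
theorem exists_frame_of_disjoint (H : Gr k n) {T : Submodule ℂ (Fin n → ℂ)}
    (hT : Disjoint H.1 T) : ∃ e : Frame k n, ofModel e 0 = H ∧ T ≤ e.vert := by
  obtain ⟨V, hTV, hV⟩ : ∃ V, T ≤ V ∧ IsCompl V H.1 := hT.symm.exists_isCompl
  replace hV := hV.symm
  have h1 : Module.finrank ℂ H.1 = k := H.2
  have h2 : Module.finrank ℂ V = n - k := by
    have := Submodule.finrank_add_eq_of_isCompl hV
    rw [h1, Module.finrank_fin_fun] at this
    omega
  let a : (Fin k → ℂ) ≃ₗ[ℂ] H.1 := LinearEquiv.ofFinrankEq _ _ (by simp [h1])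
  let b : (Fin (n - k) → ℂ) ≃ₗ[ℂ] V := LinearEquiv.ofFinrankEq _ _ (by simp [h2])
  let e : Frame k n := (a.prodCongr b).trans (Submodule.prodEquivOfIsCompl H.1 V hV)
  refine ⟨e, Subtype.ext (Submodule.eq_of_le_of_finrank_eq ?_ ((ofModel e 0).2.trans H.2.symm)), ?_⟩
  · intro v hv
    rw [mem_ofModel] at hv
    have h3 : v = e ((e.symm v).1, 0) := by
      rw [← e.symm_apply_eq]
      exact Prod.ext rfl hv
    rw [h3]
    simp [e]
  · intro v hv
    exact ⟨b.symm ⟨v, hTV hv⟩, by simp [e]⟩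

/-- The chart of a frame as an open partial homeomorphism. -/
def chartHomeo (e : Frame k n) : OpenPartialHomeomorph (Gr k n) (Model k n) :=
  (core k n).openPartialHomeomorph (chart e) ⟨e, rfl⟩

theorem chartHomeo_mem_atlas (e : Frame k n) : chartHomeo e ∈ atlas (Model k n) (Gr k n) :=
  Set.mem_iUnion₂.2 ⟨chart e, ⟨e, rfl⟩, rfl⟩

theorem ofModel_chartHomeo (e : Frame k n) {H : Gr k n} (hH : H ∈ (chartHomeo e).source) :
    ofModel e (chartHomeo e H) = H :=
  (chartHomeo e).left_inv hH

theorem chartHomeo_ofModel (e : Frame k n) (A : Model k n) : chartHomeo e (ofModel e A) = A :=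
  (chartHomeo e).right_inv trivial

theorem ofModel_mem_source (e : Frame k n) (A : Model k n) : ofModel e A ∈ (chartHomeo e).source :=
  (chartHomeo e).map_target trivial

/-- Equality of planes given in two charts is a closed condition on the pair of coordinates; no
invertibility is required, since an inclusion of `k`-planes is an equality. -/
theorem ofModel_eq_iff_transBot_eq (e e' : Frame k n) (A A' : Model k n) :
    ofModel e A = ofModel e' A' ↔ transBot e e' A = A' ∘L transTop e e' A := by
  constructor
  · intro h
    obtain ⟨hinv, rfl⟩ := (ofModel_eq_iff e e' A A').1 h
    ext1 x
    simp [hinv.inverse_apply_self]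
  · intro h
    refine Subtype.ext (Submodule.eq_of_le_of_finrank_eq (fun v hv => ?_)
      ((ofModel e A).2.trans (ofModel e' A').2.symm))
    rw [mem_ofModel] at hv ⊢
    have h1 := DFunLike.congr_fun h (e.symm v).1
    have h2 : e ((e.symm v).1, A (e.symm v).1) = v := by
      rw [← hv]; simp
    simpa [transBot, transTop, h2] using h1

theorem isOpen_injective_ofModel (e : Fin h → Frame k n) :
    IsOpen {A : Fin h → Model k n | Function.Injective fun j => ofModel (e j) (A j)} := by
  have h1 : {A : Fin h → Model k n | Function.Injective fun j => ofModel (e j) (A j)} =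
      ⋂ j, ⋂ l, ⋂ _ : j ≠ l,
        {A | transBot (e j) (e l) (A j) = A l ∘L transTop (e j) (e l) (A j)}ᶜ := by
    ext A
    simp only [Set.mem_iInter, Set.mem_compl_iff, Set.mem_ofPred_eq, ← ofModel_eq_iff_transBot_eq]
    exact ⟨fun h j l hjl hA => hjl (h hA), fun h j l hA => by_contra fun hjl => h j l hjl hA⟩
  rw [h1]
  refine isOpen_iInter_of_finite fun j => isOpen_iInter_of_finite fun l =>
    isOpen_iInter_of_finite fun _ => (isClosed_eq ?_ ?_).isOpen_compl
  · exact (contDiff_transBot (e j) (e l)).continuous.comp (continuous_apply j)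
  · exact (continuous_apply l).clm_comp
      ((contDiff_transTop (e j) (e l)).continuous.comp (continuous_apply j))

/-- The sum of the maps `ℂᵏ → ℂⁿ` given by the first `k` vectors of the frames. -/
def horMap (e : Fin h → Frame k n) : (Fin h → Fin k → ℂ) →L[ℂ] (Fin n → ℂ) :=
  LinearMap.toContinuousLinearMap
    (∑ j, (e j).toLinearMap ∘ₗ LinearMap.inl ℂ _ _ ∘ₗ LinearMap.proj j)

/-- The part of the columns of the block matrices `(I ; A j)` in the span of the last `n - k`
vectors of the frames; it depends linearly on `A`. -/
def vertMap (e : Fin h → Frame k n) :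
    (Fin h → Model k n) →L[ℂ] (Fin h → Fin k → ℂ) →L[ℂ] (Fin n → ℂ) :=
  LinearMap.toContinuousLinearMap (E := Fin h → Model k n)
    { toFun := fun A => LinearMap.toContinuousLinearMap
        (∑ j, (e j).toLinearMap ∘ₗ LinearMap.inr ℂ _ _ ∘ₗ (A j).toLinearMap ∘ₗ LinearMap.proj j)
      map_add' := fun A B => by
        ext1 x
        simp [← Finset.sum_add_distrib, ← map_add]
      map_smul' := fun c A => by
        ext1 x
        simp only [LinearMap.coe_toContinuousLinearMap', LinearMap.sum_apply, smul_apply,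
          RingHom.id_apply, Finset.smul_sum]
        refine Finset.sum_congr rfl fun j _ => ?_
        change e j (0, c • A j (x j)) = c • e j (0, A j (x j))
        rw [← map_smul (e j), Prod.smul_mk, smul_zero] }

theorem horMap_apply (e : Fin h → Frame k n) (x : Fin h → Fin k → ℂ) :
    horMap e x = ∑ j, e j (x j, 0) := by
  simp [horMap]

theorem vertMap_apply (e : Fin h → Frame k n) (A : Fin h → Model k n) (x : Fin h → Fin k → ℂ) :
    vertMap e A x = ∑ j, e j (0, A j (x j)) := by
  simp [vertMap]

theorem horMap_add_vertMap_apply (e : Fin h → Frame k n) (A : Fin h → Model k n)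
    (x : Fin h → Fin k → ℂ) : (horMap e + vertMap e A) x = ∑ j, e j (x j, A j (x j)) := by
  rw [add_apply, horMap_apply, vertMap_apply, ← Finset.sum_add_distrib]
  exact Finset.sum_congr rfl fun j _ => by rw [← map_add]; simp

theorem range_horMap_add_vertMap (e : Fin h → Frame k n) (A : Fin h → Model k n) :
    LinearMap.range (horMap e + vertMap e A).toLinearMap = ⨆ j, (ofModel (e j) (A j)).1 := by
  apply le_antisymm
  · rintro _ ⟨x, rfl⟩
    change (horMap e + vertMap e A) x ∈ _
    rw [horMap_add_vertMap_apply]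
    refine Submodule.sum_mem _ fun j _ => Submodule.mem_iSup_of_mem j ?_
    simp [mem_ofModel]
  · refine iSup_le fun j v hv => ?_
    rw [mem_ofModel] at hv
    refine ⟨Pi.single j ((e j).symm v).1, ?_⟩
    change (horMap e + vertMap e A) _ = _
    rw [horMap_add_vertMap_apply, Finset.sum_eq_single j]
    · rw [Pi.single_eq_same, ← hv]
      simp
    · intro l _ hl
      rw [Pi.single_eq_of_ne hl, map_zero]
      exact map_zero (e l)
    · simp

/-- The matrices whose columns, read in the frames, are prescribed vectors of `T`. It inverts the
`T`-component of `vertMap` when `T` lies in the vertical space of each frame. -/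
def vertLift (e : Fin h → Frame k n) (T : Submodule ℂ (Fin n → ℂ)) :
    ((Fin h → Fin k → ℂ) →L[ℂ] T) →L[ℂ] (Fin h → Model k n) :=
  LinearMap.toContinuousLinearMap (E := (Fin h → Fin k → ℂ) →L[ℂ] T) (F' := Fin h → Model k n)
    { toFun := fun f j => LinearMap.toContinuousLinearMap
        (LinearMap.snd ℂ _ _ ∘ₗ (e j).symm.toLinearMap ∘ₗ T.subtype ∘ₗ f.toLinearMap ∘ₗ
          LinearMap.single ℂ (fun _ => Fin k → ℂ) j)
      map_add' := fun f g => by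
        ext j : 2
        simp
      map_smul' := fun c f => by
        ext j : 2
        simp }

theorem vertMap_vertLift {e : Fin h → Frame k n} {T : Submodule ℂ (Fin n → ℂ)}
    (hT : ∀ j, T ≤ (e j).vert) (f : (Fin h → Fin k → ℂ) →L[ℂ] T) (x : Fin h → Fin k → ℂ) :
    vertMap e (vertLift e T f) x = f x := by
  have h1 : ∀ j (t : T), e j (0, ((e j).symm t).2) = t := by
    intro j t
    rw [← (mem_vert (e j) t).1 (hT j t.2)]
    simp
  have h2 : ∀ j, vertLift e T f j (x j) = ((e j).symm (f (Pi.single j (x j)))).2 := by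
    intro j
    simp [vertLift]
  rw [vertMap_apply]
  simp only [h2, h1]
  rw [← Submodule.coe_sum, ← map_sum, Finset.univ_sum_single]

end Gr

/-! ### The submanifold chart -/

/-- A local biholomorphism of the coordinate space of `Gr(k, n)^h` belongs to the groupoid of its
complex structure. -/
theorem mem_contDiffGroupoid_grPowModel {h k n : ℕ}
    {f : OpenPartialHomeomorph (Fin h → Gr.Model k n) (Fin h → Gr.Model k n)}
    (hf : ContDiffOn ℂ ω f f.source) (hf' : ContDiffOn ℂ ω f.symm f.target) :
    (show OpenPartialHomeomorph (ModelPi fun _ : Fin h => Gr.Model k n)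
      (ModelPi fun _ : Fin h => Gr.Model k n) from f) ∈
      contDiffGroupoid ω (grPowModel h k n) := by
  refine mem_groupoid_of_pregroupoid.2 ⟨?_, ?_⟩
  · exact hf.mono fun _ hx => hx.1
  · exact hf'.mono fun _ hx => hx.1

open Gr in
/-- Near a point of the configuration space, whose planes have sum `S`, the configuration space is
cut out by a linear subspace of codimension `(hk - i)(n - i)`. -/
theorem exists_submanifold_chart {h i k n : ℕ} {P : Fin h → Gr k n}
    (hP : P ∈ orderedConfig h i k n) :
    ∃ φ ∈ IsManifold.maximalAtlas (grPowModel h k n) ω (Fin h → Gr k n), P ∈ φ.source ∧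
      ∃ W : Submodule ℂ (Fin h → Gr.Model k n),
        i ≤ h * k ∧ i ≤ n ∧
        Module.finrank ℂ W + (h * k - i) * (n - i) = h * (k * (n - k)) ∧
        ∀ y ∈ φ.source, y ∈ orderedConfig h i k n ↔ φ.extend (grPowModel h k n) y ∈ W := by
  obtain ⟨hinj, hi⟩ := hP
  obtain ⟨T, hST⟩ := Submodule.exists_isCompl (⨆ j, (P j).1)
  have hPS : ∀ j, (P j).1 ≤ ⨆ j, (P j).1 := fun j => le_iSup (fun j => (P j).1) j
  generalize hS : (⨆ j, (P j).1) = S at hST hi hPS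
  choose e he hTe using fun j => exists_frame_of_disjoint (P j) (hST.disjoint.mono_left (hPS j))
  let σ : (Fin n → ℂ) →L[ℂ] S := LinearMap.toContinuousLinearMap (S.projectionOnto T hST)
  let τ : (Fin n → ℂ) →L[ℂ] T := LinearMap.toContinuousLinearMap (T.projectionOnto S hST.symm)
  let L : (Fin h → Gr.Model k n) → (Fin h → Fin k → ℂ) →L[ℂ] S :=
    fun A => σ ∘L (horMap e + vertMap e A)
  let D : (Fin h → Gr.Model k n) →L[ℂ] (Fin h → Fin k → ℂ) →L[ℂ] T :=
    (ContinuousLinearMap.compL ℂ _ _ _ τ) ∘L vertMap e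
  have hL : ContDiff ℂ ω L :=
    contDiff_const.clm_comp (contDiff_const.add (vertMap e).contDiff)
  -- Moving the planes in the direction of `T` does not change the `S`-component of their sum.
  have hLs : ∀ A f, L (A + vertLift e T f) = L A := by
    intro A f
    ext1 x
    change σ (horMap e x + vertMap e (A + _) x) = σ (horMap e x + vertMap e A x)
    rw [map_add (vertMap e), add_apply, vertMap_vertLift hTe, ← add_assoc, map_add σ]
    simp [σ]
  have hDs : ∀ f, D (vertLift e T f) = f := by
    intro f
    ext1 x
    change τ (vertMap e _ x) = f x
    rw [vertMap_vertLift hTe]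
    simp [τ]
  -- The planes at the origin of the charts lie in `S`, so `D A` is the whole `T`-component.
  have hτhor : ∀ x, τ (horMap e x) = 0 := by
    intro x
    refine (Submodule.projectionOnto_apply_eq_zero_iff hST.symm).2 ?_
    rw [horMap_apply]
    refine Submodule.sum_mem _ fun j _ => hPS j ?_
    rw [← he j]
    exact apply_inl_mem_ofModel_zero (e j) (x j)
  have hDτ : ∀ A x, D A x = τ ((horMap e + vertMap e A) x) := by
    intro A x
    rw [add_apply, map_add, hτhor, zero_add]
    rfl
  -- At the origin of the charts the planes add up to `S`.
  have hsurj : Function.Surjective (L 0) := by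
    intro y
    have h1 : (y : Fin n → ℂ) ∈ LinearMap.range (horMap e + vertMap e 0).toLinearMap := by
      rw [range_horMap_add_vertMap]
      simp only [Pi.zero_apply, he, hS, y.2]
    obtain ⟨x, hx⟩ := h1
    refine ⟨x, ?_⟩
    change σ ((horMap e + vertMap e 0).toLinearMap x) = y
    rw [hx]
    simp [σ]
  obtain ⟨r', hr'⟩ := (L 0).toLinearMap.exists_rightInverse_of_surjective
    (LinearMap.range_eq_top.2 hsurj)
  let r : S →L[ℂ] (Fin h → Fin k → ℂ) := LinearMap.toContinuousLinearMap r'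
  have hr : L 0 ∘L r = ContinuousLinearMap.id ℂ S := by
    ext1 y
    exact DFunLike.congr_fun hr' y
  have h0 : (L 0 ∘L r).IsInvertible := by
    rw [hr]
    exact ⟨ContinuousLinearEquiv.refl ℂ S, rfl⟩
  let F := straighten hL hLs hDs h0
  let Ω : Set (Fin h → Gr.Model k n) := {A | Function.Injective fun j => ofModel (e j) (A j)}
  have hΩ : IsOpen Ω := isOpen_injective_ofModel e
  let ψ : OpenPartialHomeomorph (Fin h → Gr k n) (ModelPi fun _ : Fin h => Gr.Model k n) :=
    OpenPartialHomeomorph.pi fun j => chartHomeo (e j)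
  have hψ : ψ ∈ IsManifold.maximalAtlas (grPowModel h k n) ω (Fin h → Gr k n) :=
    IsManifold.subset_maximalAtlas
      ⟨fun j => chartHomeo (e j), fun j _ => chartHomeo_mem_atlas (e j), rfl⟩
  -- Restricting to `Ω` keeps the planes distinct throughout the chart.
  have hF : (show OpenPartialHomeomorph (ModelPi fun _ : Fin h => Gr.Model k n)
      (ModelPi fun _ : Fin h => Gr.Model k n) from F.restr Ω) ∈
      contDiffGroupoid ω (grPowModel h k n) :=
    closedUnderRestriction' (mem_contDiffGroupoid_grPowModel
      (contDiffOn_straighten hL hLs hDs h0) (contDiffOn_straighten_symm hL hLs hDs h0)) hΩ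
  -- `W` is the space of all `A` for which `D A` vanishes on `ker (L 0)`.
  let Θ : (Fin h → Gr.Model k n) →ₗ[ℂ] (LinearMap.ker (L 0).toLinearMap →ₗ[ℂ] T) :=
    { toFun := fun A => (D A).toLinearMap.domRestrict _
      map_add' := fun A B => by
        ext1 x
        simp
      map_smul' := fun c A => by
        ext1 x
        simp }
  let W : Submodule ℂ (Fin h → Gr.Model k n) := LinearMap.ker Θ
  have hW : ∀ A, A ∈ W ↔ ∀ x, L 0 x = 0 → D A x = 0 := by
    intro A
    constructor
    · intro hA x hx
      exact DFunLike.congr_fun (LinearMap.mem_ker.1 hA) ⟨x, hx⟩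
    · intro hA
      refine LinearMap.mem_ker.2 (LinearMap.ext fun x => hA x x.2)
  have hfT : i + Module.finrank ℂ T = n := by
    rw [← hi, Submodule.finrank_add_eq_of_isCompl hST, Module.finrank_fin_fun]
  have hfK : i + Module.finrank ℂ (LinearMap.ker (L 0).toLinearMap) = h * k := by
    have h1 := LinearMap.finrank_range_add_finrank_ker (L 0).toLinearMap
    rw [LinearMap.range_eq_top.2 hsurj, finrank_top, hi] at h1
    rw [h1, Module.finrank_pi_fintype]
    simp
  refine ⟨ψ ≫ₕ (show OpenPartialHomeomorph (ModelPi fun _ : Fin h => Gr.Model k n)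
      (ModelPi fun _ : Fin h => Gr.Model k n) from F.restr Ω),
    StructureGroupoid.trans_mem_maximalAtlas hψ hF, ?_, W, by omega, by omega, ?_, ?_⟩
  · have h1 : ψ P = (0 : Fin h → Gr.Model k n) := by
      funext j
      change chartHomeo (e j) (P j) = 0
      rw [← he j, chartHomeo_ofModel]
    rw [OpenPartialHomeomorph.trans_source]
    refine ⟨fun j _ => ?_, ?_⟩
    · rw [← he j]
      exact ofModel_mem_source (e j) 0
    · change ψ P ∈ F.source ∩ interior Ω
      rw [h1, hΩ.interior_eq]
      refine ⟨h0, ?_⟩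
      change Function.Injective fun j => ofModel (e j) 0
      simpa only [he] using hinj
  · have hsurj' : Function.Surjective Θ := by
      intro g
      obtain ⟨g', hg'⟩ := LinearMap.exists_extend g
      refine ⟨vertLift e T (LinearMap.toContinuousLinearMap g'), ?_⟩
      ext1 x
      change D (vertLift e T (LinearMap.toContinuousLinearMap g')) x = g x
      rw [hDs, ← hg']
      rfl
    have h1 := LinearMap.finrank_range_add_finrank_ker (V := Fin h → Gr.Model k n)
      (V₂ := LinearMap.ker (L 0).toLinearMap →ₗ[ℂ] T) Θ
    rw [LinearMap.range_eq_top.2 hsurj', finrank_top, Module.finrank_linearMap,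
      Module.finrank_pi_fintype, Finset.sum_const, Finset.card_univ, Fintype.card_fin, smul_eq_mul,
      ← LinearMap.toContinuousLinearMap.finrank_eq, Module.finrank_linearMap,
      Module.finrank_fin_fun, Module.finrank_fin_fun] at h1
    have h2 : h * k - i = Module.finrank ℂ (LinearMap.ker (L 0).toLinearMap) := by omega
    have h3 : n - i = Module.finrank ℂ T := by omega
    rw [← h1, add_comm, h2, h3]
  · intro y hy
    rw [OpenPartialHomeomorph.trans_source] at hy
    obtain ⟨hy1, hy2⟩ := hy
    have hyA : ∀ j, ofModel (e j) (chartHomeo (e j) (y j)) = y j :=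
      fun j => ofModel_chartHomeo (e j) (hy1 j trivial)
    generalize hA : (fun j => chartHomeo (e j) (y j)) = A at *
    replace hyA : (fun j => ofModel (e j) (A j)) = y := by
      rw [← hA]
      exact funext hyA
    have hψy : ψ y = A := hA
    change ψ y ∈ F.source ∩ interior Ω at hy2
    rw [hψy, hΩ.interior_eq] at hy2
    change _ ↔ F (ψ y) ∈ W
    rw [hψy, hW, ← ker_le_ker_iff_straighten hL hLs hDs h0 hy2.1]
    have hLA : Function.Surjective (S.projectionOnto T hST ∘ₗ
        (horMap e + vertMap e A).toLinearMap) := by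
      intro z
      have h2 : (L A ∘L r).IsInvertible := hy2.1
      exact ⟨r ((L A ∘L r).inverse z), h2.self_apply_inverse z⟩
    have h3 := finrank_range_eq_iff_ker_le hST (horMap e + vertMap e A).toLinearMap hLA
    rw [range_horMap_add_vertMap, hi] at h3
    have h4 : y ∈ orderedConfig h i k n ↔
        Module.finrank ℂ ↥(⨆ j, (ofModel (e j) (A j)).1) = i := by
      rw [← hyA]
      exact ⟨fun h => h.2, fun h => ⟨hy2.2, h⟩⟩
    rw [h4, h3]
    simp only [hDτ]
    rfl

end

theorem mainTheorem1 (h i k n : ℕ) (hk : 0 < k) (hkn : k < n) (hh : 1 ≤ h)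
    (hne : (orderedConfig h i k n).Nonempty) :
    ∃ d : ℕ, (d : ℤ) = (i : ℤ) * ((n : ℤ) - i) + (h : ℤ) * k * ((i : ℤ) - k) ∧
      IsComplexSubmanifold (grPowModel h k n) (orderedConfig h i k n) d := by
  -- `hk(n - k) - (hk - i)(n - i) = i(n - i) + hk(i - k)`; the bounds on `i` make the
  -- natural-number subtractions exact.
  have key : ∀ d : ℕ, i ≤ h * k → i ≤ n →
      d + (h * k - i) * (n - i) = h * (k * (n - k)) →
      (d : ℤ) = (i : ℤ) * ((n : ℤ) - i) + (h : ℤ) * k * ((i : ℤ) - k) := by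
    intro d h1 h2 h3
    zify [h1, h2, hkn.le] at h3
    linear_combination h3
  obtain ⟨P, hP⟩ := hne
  obtain ⟨-, -, -, W, h1, h2, h3, -⟩ := exists_submanifold_chart hP
  refine ⟨Module.finrank ℂ W, key _ h1 h2 h3, fun Q hQ => ?_⟩
  obtain ⟨φ, hφ, hQφ, W', h1', h2', h3', hW'⟩ := exists_submanifold_chart hQ
  refine ⟨φ, hφ, hQφ, W', ?_, hW'⟩
  have h4 := (key _ h1 h2 h3).symm.trans (key _ h1 h2 h3)
  omega
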